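/- All graphs are finite and simple. For a graph $G$ let $n(G)$ and $e(G)$ be its numbers of vertices and edges, let $\Phi(G)$ be its number of perfect matchings, and let $c(G)=e(G)-\tfrac14 n(G)^2$ be its excess. An edge of $G$ is extendable if some perfect matching of $G$ contains it. A connected graph is 1-extendable if all its edges are extendable. A graph is elementary if it has a perfect matching and the spanning subgraph formed by its extendable edges is connected. For a 1-extendable graph $H$ let $\mathcal E(H)$ be the set of elementary graphs $G\supseteq H$ with $V(G)=V(H)$ and $\Phi(G)=\Phi(H)$. An ear augmentation of a graph $H$ adds to $H$ at least one and finitely many new paths (ears), each joining two distinct vertices of $H$, having an even number (possibly $0$) of internal vertices, none of which lies in $H$, and using no edge of $H$; distinct ears have no internal vertex and no edge in common. A graded ear decomposition is a sequence $H_0\subset H_1\subset\dots\subset H_k$ ($k\ge 0$) of 1-extendable graphs in which each $H_{i+1}$ arises from $H_i$ by an ear augmentation; then $H_k$ is said to be reachable from $H_0$ by a graded ear decomposition. Let $p,c\ge 1$ be integers. Let $H$ be a 1-extendable graph, let $q=\Phi(H)$, and let $c'$ be the maximum of $c(G)$ over all $G\in\mathcal E(H)$. If $c'+2(p-q)<c$,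 then there is no 1-extendable graph $H'$ reachable from $H$ by a graded ear decomposition such that $\Phi(H')=p$ and some $G'\in\mathcal E(H')$ satisfies $c(G')\ge c$. -/

import Mathlib

namespace PMExcess

/-- The number `Φ(G)` of perfect matchings of `G`. -/
noncomputable def numPM {V : Type*} (G : SimpleGraph V) : ℕ :=
  {M : G.Subgraph | M.IsPerfectMatching}.ncard

/-- The excess `c(G) = e(G) - n(G)² / 4`. -/
noncomputable def excess {V : Type*} (G : SimpleGraph V) : ℚ :=
  (G.edgeSet.ncard : ℚ) - (Nat.card V : ℚ) ^ 2 / 4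

/-- `e` is an extendable edge of `G`: some perfect matching of `G` contains it. -/
def IsExtendable {V : Type*} (G : SimpleGraph V) (e : Sym2 V) : Prop :=
  ∃ M : G.Subgraph, M.IsPerfectMatching ∧ e ∈ M.edgeSet

/-- The spanning subgraph of `G` formed by the extendable edges. -/
def extendableSubgraph {V : Type*} (G : SimpleGraph V) : SimpleGraph V :=
  SimpleGraph.fromEdgeSet {e | IsExtendable G e}

/-- `G` is elementary: it has a perfect matching and its extendable subgraph is connected. -/
def IsElementary {V : Type*} (G : SimpleGraph V) : Prop :=
  (∃ M : G.Subgraph, M.IsPerfectMatching) ∧ (extendableSubgraph G).Connected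

/-- `G` is 1-extendable: it is connected and each of its edges is extendable. -/
def IsOneExtendable {V : Type*} (G : SimpleGraph V) : Prop :=
  G.Connected ∧ ∀ e ∈ G.edgeSet, IsExtendable G e

/-- `ℰ(H)`: the elementary supergraphs of `H` on the vertex set of `H` that have the same
number of perfect matchings as `H`. -/
def elementarySupergraphs {V : Type*} (H : SimpleGraph V) : Set (SimpleGraph V) :=
  {G | IsElementary G ∧ H ≤ G ∧ numPM G = numPM H}

/-- A graph whose vertices are taken from the type `U`: a vertex set together with an adjacency
relation on it, that is, a subgraph of the complete graph on `U`. -/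
abbrev GraphIn (U : Type*) := (⊤ : SimpleGraph U).Subgraph

/-- An ear that can be added to `H`: a path between two distinct vertices of `H`, whose
internal vertices do not belong to `H` and whose edges are not edges of `H`. -/
structure Ear {U : Type*} (H : GraphIn U) where
  x : U
  y : U
  path : (⊤ : SimpleGraph U).Walk x y
  isPath : path.IsPath
  ne : x ≠ y
  x_mem : x ∈ H.verts
  y_mem : y ∈ H.verts
  internal_new : ∀ v ∈ path.support, v ≠ x → v ≠ y → v ∉ H.verts
  edges_new : ∀ e ∈ path.edges, e ∉ H.edgeSet

/-- The set of internal vertices of an ear. -/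
def Ear.internal {U : Type*} {H : GraphIn U} (ε : Ear H) : Set U :=
  {v | v ∈ ε.path.support ∧ v ≠ ε.x ∧ v ≠ ε.y}

/-- The order of an ear: its number of internal vertices. -/
noncomputable def Ear.order {U : Type*} {H : GraphIn U} (ε : Ear H) : ℕ :=
  ε.internal.ncard

/-- `H'` arises from `H` by adding finitely many (at least one) ears to `H`, each of even order,
with no internal vertex and no edge in common. -/
def IsEarAugmentation {U : Type*} (H H' : GraphIn U) : Prop :=
  ∃ (m : ℕ) (ε : Fin (m + 1) → Ear H),
    (∀ i, Even (ε i).order) ∧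
    (∀ i j, i ≠ j → Disjoint (ε i).internal (ε j).internal ∧
      List.Disjoint (ε i).path.edges (ε j).path.edges) ∧
    H' = H ⊔ ⨆ i, (ε i).path.toSubgraph

/-- The sequence `F 0 ⊂ F 1 ⊂ ⋯ ⊂ F k` is a graded ear decomposition: every member is
1-extendable, and each member arises from the preceding one by an ear augmentation. -/
def IsGradedEarDecomposition {U : Type*} {k : ℕ} (F : Fin (k + 1) → GraphIn U) : Prop :=
  (∀ i, IsOneExtendable (F i).coe) ∧
  ∀ i : Fin k, IsEarAugmentation (F i.castSucc) (F i.succ)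

/-- `H'` is reachable from `H` by a graded ear decomposition. -/
def IsReachable {U : Type*} (H H' : GraphIn U) : Prop :=
  ∃ (k : ℕ) (F : Fin (k + 1) → GraphIn U),
    IsGradedEarDecomposition F ∧ F 0 = H ∧ F (Fin.last k) = H'

end PMExcess

namespace PMExcess

/-! Even ears leave the vertices outside `H` perfectly matched among themselves by some `μ`, so
every perfect matching of the graph `K` induced by `G'` on `V(H)` extends to `G'`. By
`excess_comap_le`, any excess `G'` has beyond that of `K` is paid for by additional perfect
matchings: c(G') - c(K) ≤ Φ(G') - Φ(K). This rests on the alternating 4-cycle count in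
`two_mul_card_darts_le`. Deleting one edge per surplus matching of `K`
(`exists_between_matchingFun_eq`) gives a member of ℰ(H) with excess at least c(K) - (Φ(K) - q).
Together c(G') ≤ c' + (p - q); since q ≤ p, this is at most c' + 2(p - q) < c. -/

/-! ### Perfect matchings as involutions -/

/-- The perfect matchings of `G`, described by the involutions that match every vertex with its
partner. -/
def matchingFun {V : Type*} (G : SimpleGraph V) : Set (V → V) :=
  {f | ∀ v, G.Adj v (f v) ∧ f (f v) = v}

/-- The perfect matching belonging to an element of `matchingFun G`. -/
def toMatching {V : Type*} {G : SimpleGraph V} (f : V → V) (hf : f ∈ matchingFun G) :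
    G.Subgraph where
  verts := Set.univ
  Adj a b := f a = b
  adj_sub := by
    rintro a b rfl
    exact (hf a).1
  edge_vert _ := Set.mem_univ _
  symm := ⟨by
    rintro a b rfl
    exact (hf a).2⟩

theorem toMatching_isPerfectMatching {V : Type*} {G : SimpleGraph V} (f : V → V)
    (hf : f ∈ matchingFun G) : (toMatching f hf).IsPerfectMatching := by
  rw [SimpleGraph.Subgraph.isPerfectMatching_iff]
  intro v
  exact ⟨f v, rfl, fun y hy => Eq.symm (a := f v) hy⟩

theorem exists_toMatching_eq {V : Type*} {G : SimpleGraph V} (M : G.Subgraph)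
    (hM : M.IsPerfectMatching) : ∃ f, ∃ hf : f ∈ matchingFun G, toMatching f hf = M := by
  choose f hf hf' using SimpleGraph.Subgraph.isPerfectMatching_iff.1 hM
  refine ⟨f, fun v => ⟨(hf v).adj_sub, (hf' _ _ (hf v).symm).symm⟩, ?_⟩
  ext a b
  · simp [toMatching, hM.2 a]
  · constructor
    · rintro rfl
      exact hf a
    · intro h
      exact (hf' _ _ h).symm

theorem numPM_eq {V : Type*} (G : SimpleGraph V) : numPM G = (matchingFun G).ncard := by
  symm
  refine Set.ncard_congr (fun f hf => toMatching f hf)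
    (fun f hf => toMatching_isPerfectMatching f hf) ?_ ?_
  · intro f g hf hg h
    funext a
    have : (toMatching f hf).Adj a (f a) := rfl
    rw [h] at this
    exact Eq.symm (a := g a) this
  · intro M hM
    obtain ⟨f, hf, h⟩ := exists_toMatching_eq M hM
    exact ⟨f, hf, h⟩

theorem matchingFun_mono {V : Type*} {G K : SimpleGraph V} (h : G ≤ K) :
    matchingFun G ⊆ matchingFun K :=
  fun _ hf v => ⟨h (hf v).1, (hf v).2⟩

theorem exists_isPerfectMatching_iff {V : Type*} {G : SimpleGraph V} :
    (∃ M : G.Subgraph, M.IsPerfectMatching) ↔ (matchingFun G).Nonempty := by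
  constructor
  · rintro ⟨M, hM⟩
    obtain ⟨f, hf, -⟩ := exists_toMatching_eq M hM
    exact ⟨f, hf⟩
  · rintro ⟨f, hf⟩
    exact ⟨_, toMatching_isPerfectMatching f hf⟩

theorem isExtendable_mono {V : Type*} {G K : SimpleGraph V} (h : G ≤ K) {e : Sym2 V}
    (he : IsExtendable G e) : IsExtendable K e := by
  obtain ⟨M, hM, heM⟩ := he
  obtain ⟨f, hf, rfl⟩ := exists_toMatching_eq M hM
  refine ⟨toMatching f (matchingFun_mono h hf), toMatching_isPerfectMatching _ _, ?_⟩
  induction e with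
  | _ a b => exact heM

/-- Extendability survives adding edges, so membership in ℰ(H) reduces to containing `H` and having
the right matching count. -/
theorem isElementary_of_le {V : Type*} {H G : SimpleGraph V} (hH : IsOneExtendable H)
    (hne : (matchingFun H).Nonempty) (h : H ≤ G) : IsElementary G := by
  refine ⟨exists_isPerfectMatching_iff.2 (hne.mono (matchingFun_mono h)), hH.1.mono ?_⟩
  intro a b hab
  rw [extendableSubgraph, SimpleGraph.fromEdgeSet_adj]
  exact ⟨isExtendable_mono h (hH.2 s(a, b) hab), hab.ne⟩

/-! ### Removing surplus matchings -/

/-- By deleting one edge for each perfect matching of `K` that is not one of `H`, one obtains a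
graph between `H` and `K` with the same perfect matchings as `H`. -/
theorem exists_between_matchingFun_eq {V : Type*} [Finite V] {H K : SimpleGraph V} (h : H ≤ K) :
    ∃ G, H ≤ G ∧ G ≤ K ∧ matchingFun G = matchingFun H ∧
      K.edgeSet.ncard + (matchingFun H).ncard ≤ G.edgeSet.ncard + (matchingFun K).ncard := by
  have key : ∀ f : ↥(matchingFun K \ matchingFun H), ∃ e ∉ H.edgeSet, ∃ v, e = s(v, f.1 v) := by
    rintro ⟨f, hfK, hfH⟩
    have : ∃ v, ¬ H.Adj v (f v) := by
      by_contra! hcon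
      exact hfH fun v => ⟨hcon v, (hfK v).2⟩
    obtain ⟨v, hv⟩ := this
    exact ⟨s(v, f v), hv, v, rfl⟩
  choose r hr using key
  set R := r '' Set.univ
  have hle : H ≤ K.deleteEdges R := by
    intro a b hab
    rw [SimpleGraph.deleteEdges_adj]
    refine ⟨h hab, ?_⟩
    rintro ⟨f, -, hfe⟩
    exact (hr f).1 (hfe ▸ hab)
  refine ⟨K.deleteEdges R, hle, SimpleGraph.deleteEdges_le _, ?_, ?_⟩
  · refine (Set.Subset.antisymm (matchingFun_mono hle) ?_).symm
    intro f hf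
    by_contra hfH
    have hfK : f ∈ matchingFun K \ matchingFun H :=
      ⟨matchingFun_mono (SimpleGraph.deleteEdges_le _) hf, hfH⟩
    obtain ⟨-, v, hv⟩ := hr ⟨f, hfK⟩
    exact (SimpleGraph.deleteEdges_adj.1 (hf v).1).2 (hv ▸ ⟨⟨f, hfK⟩, trivial, rfl⟩)
  · rw [SimpleGraph.edgeSet_deleteEdges]
    have h1 : K.edgeSet.ncard ≤ (K.edgeSet \ R).ncard + R.ncard := by
      have := Set.ncard_le_ncard_sdiff_add_ncard K.edgeSet R
      omega
    have h2 : R.ncard ≤ (matchingFun K \ matchingFun H).ncard := by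
      refine (Set.ncard_image_le Set.finite_univ).trans ?_
      rw [Set.ncard_univ, Nat.card_coe_set_eq]
    have h3 := Set.ncard_sdiff_add_ncard_of_subset (matchingFun_mono h)
    omega

/-! ### Counting by alternating 4-cycles -/

/-- The perfect matching obtained from `f` by replacing the edges at `a` and `c` by the edges
joining `a` to `c` and the partner of `a` to the partner of `c`. -/
noncomputable def switch {W : Type*} (f : W → W) (a c : W) : W → W := by
  classical exact fun w =>
    if w = a then c else if w = c then a else if w = f a then f c else if w = f c then f a else f w

theorem switch_mem {W : Type*} {G : SimpleGraph W} {f : W → W} (hf : f ∈ matchingFun G) {a c : W}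
    (hc : c ≠ f a) (h1 : G.Adj a c) (h2 : G.Adj (f a) (f c)) :
    switch f a c ∈ matchingFun G := by
  classical
  have hff : ∀ w, f (f w) = w := fun w => (hf w).2
  have hne : ∀ w, w ≠ f w := fun w => (hf w).1.ne
  have hac := h1.ne
  intro w
  have hw := (hf w).1
  have h1' := h1.symm
  have h2' := h2.symm
  constructor
  · unfold switch
    grind
  · unfold switch
    grind

/-- Let `f` be a perfect matching of `G` that leaves `S` invariant. The number of darts of `G`
meeting `S` is bounded by the number of pairs of vertices meeting `S` and the number of perfect
matchings that differ from `f` on `S`. -/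
theorem two_mul_card_darts_le {W : Type*} [Fintype W] {G : SimpleGraph W} {f : W → W}
    (hf : f ∈ matchingFun G) {S : Set W} (hS : ∀ w ∈ S, f w ∈ S) :
    2 * {p : W × W | G.Adj p.1 p.2 ∧ (p.1 ∈ S ∨ p.2 ∈ S)}.ncard ≤
      {p : W × W | p.1 ∈ S ∨ p.2 ∈ S}.ncard +
        4 * {g ∈ matchingFun G | ∃ w ∈ S, g w ≠ f w}.ncard := by
  classical
  have hff : ∀ w, f (f w) = w := fun w => (hf w).2
  have hne : ∀ w, w ≠ f w := fun w => (hf w).1.ne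
  set T : Set (W × W) := {p : W × W | p.1 ∈ S ∨ p.2 ∈ S} with hT
  set Y : Set (W × W) := {p : W × W | G.Adj p.1 p.2 ∧ (p.1 ∈ S ∨ p.2 ∈ S)} with hY
  -- An involution sending a pair to its pair of partners. Pairs (a, a) and (a, f a) are exchanged
  -- instead, so that matching darts are sent to non-darts.
  let τ : W × W → W × W := fun p =>
    if p.2 = p.1 ∨ p.2 = f p.1 then (p.1, f p.2) else (f p.1, f p.2)
  have hτ : ∀ p, τ (τ p) = p := by
    rintro ⟨a, c⟩
    simp only [τ]
    grind
  have hτT : ∀ p ∈ T, τ p ∈ T := by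
    rintro ⟨a, c⟩ h
    simp only [τ, hT, Set.mem_ofPred_eq] at h ⊢
    grind
  have hYT : Y ⊆ T := fun p hp => hp.2
  have himg : (τ '' Y).ncard = Y.ncard :=
    Set.ncard_image_of_injective _ (Function.LeftInverse.injective hτ)
  have hunion : (Y ∪ τ '' Y).ncard ≤ T.ncard :=
    Set.ncard_le_ncard (Set.union_subset hYT (by rintro _ ⟨p, hp, rfl⟩; exact hτT p (hYT hp)))
  have hadd := Set.ncard_union_add_ncard_inter Y (τ '' Y)
  -- A dart whose image is also a dart spans an alternating 4-cycle a, c, f c, f a.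
  have hZ : ∀ p ∈ Y ∩ τ '' Y, p.2 ≠ f p.1 ∧ G.Adj p.1 p.2 ∧ G.Adj (f p.1) (f p.2) ∧
      (p.1 ∈ S ∨ p.2 ∈ S) := by
    rintro ⟨a, c⟩ ⟨hp, p', hp', hpp⟩
    have e : p' = τ (a, c) := by rw [← hpp, hτ]
    subst e
    have hac := hp.1.ne
    have h2 := hp'.1
    simp only [τ] at h2 hac ⊢
    by_cases hc : c = f a
    · simp [hc, hff] at h2
    · have : ¬ (c = a ∨ c = f a) := by grind
      rw [if_neg this] at h2
      exact ⟨hc, hp.1, h2, hp.2⟩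
  set N : Set (W → W) := {g ∈ matchingFun G | ∃ w ∈ S, g w ≠ f w} with hN
  have hZN : (Y ∩ τ '' Y).ncard ≤ 4 * N.ncard := by
    rw [Set.ncard_eq_toFinset_card' (Y ∩ τ '' Y), Set.ncard_eq_toFinset_card' N]
    have hmaps : ∀ p ∈ (Y ∩ τ '' Y).toFinset, switch f p.1 p.2 ∈ N.toFinset := by
      rintro ⟨a, c⟩ hp
      obtain ⟨h1, h2, h3, h4⟩ := hZ _ (Set.mem_toFinset.1 hp)
      simp only at h1 h2 h3 h4
      have hac := h2.ne
      rw [Set.mem_toFinset]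
      refine ⟨switch_mem hf h1 h2 h3, ?_⟩
      rcases h4 with h4 | h4
      · exact ⟨a, h4, by simpa [switch] using h1⟩
      · refine ⟨c, h4, ?_⟩
        simp only [switch]
        grind
    refine Finset.card_le_mul_card_image_of_maps_to hmaps 4 ?_
    intro g hg
    by_cases hemp : ((Y ∩ τ '' Y).toFinset.filter fun p => switch f p.1 p.2 = g) = ∅
    · rw [hemp]; simp
    obtain ⟨⟨a, c⟩, hp⟩ := Finset.nonempty_iff_ne_empty.2 hemp
    rw [Finset.mem_filter] at hp
    obtain ⟨hp, hpg⟩ := hp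
    simp only at hpg
    -- The switched matching determines a pair by its first entry, which must be one of the four
    -- vertices where `g` differs from `f`; hence the factor 4.
    have hsub : ((Y ∩ τ '' Y).toFinset.filter fun p => switch f p.1 p.2 = g) ⊆
        ({a, c, f a, f c} : Finset W).image fun w => (w, g w) := by
      rintro ⟨x, y⟩ hq
      rw [Finset.mem_filter] at hq
      obtain ⟨hq, hqg⟩ := hq
      simp only at hqg
      have hxy := (hZ _ (Set.mem_toFinset.1 hq)).1
      simp only at hxy
      have hgx : g x = y := by rw [← hqg]; simp [switch]
      rw [Finset.mem_image]
      refine ⟨x, ?_, by rw [hgx]⟩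
      by_contra hx
      simp only [Finset.mem_insert, Finset.mem_singleton, not_or] at hx
      apply hxy
      rw [← hgx, ← hpg]
      simp [switch, hx]
    exact (Finset.card_le_card hsub).trans (Finset.card_image_le.trans Finset.card_le_four)
  omega

theorem two_mul_ncard_edgeSet {V : Type*} [Finite V] (G : SimpleGraph V) :
    2 * G.edgeSet.ncard = {p : V × V | G.Adj p.1 p.2}.ncard := by
  classical
  have := Fintype.ofFinite V
  rw [Set.ncard_eq_toFinset_card' G.edgeSet, Set.ncard_eq_toFinset_card']
  have h := G.two_mul_card_edgeFinset
  rw [SimpleGraph.edgeFinset] at h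
  rw [h]
  congr 1
  ext ⟨a, b⟩
  simp

/-! ### Comparing excess with an induced subgraph -/

/-- Extend a function on `V` to `W` by `μ` outside the range of `ι`. -/
noncomputable def extendBy {V W : Type*} (ι : V ↪ W) (μ : W → W) (f : V → V) : W → W :=
  Function.extend ι (fun v => ι (f v)) μ

theorem extendBy_apply {V W : Type*} (ι : V ↪ W) (μ : W → W) (f : V → V) (v : V) :
    extendBy ι μ f (ι v) = ι (f v) :=
  ι.injective.extend_apply _ _ v

theorem extendBy_injective {V W : Type*} (ι : V ↪ W) (μ : W → W) :
    Function.Injective (extendBy ι μ) := by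
  intro f g h
  funext v
  apply ι.injective
  rw [← extendBy_apply ι μ, h, extendBy_apply]

theorem extendBy_of_notMem {V W : Type*} (ι : V ↪ W) (μ : W → W) (f : V → V) {w : W}
    (hw : w ∉ Set.range ι) : extendBy ι μ f w = μ w :=
  Function.extend_apply' _ _ _ hw

theorem extendBy_mem {V W : Type*} {ι : V ↪ W} {G : SimpleGraph W} {μ : W → W}
    (hμ : ∀ w, w ∉ Set.range ι → G.Adj w (μ w) ∧ μ w ∉ Set.range ι ∧ μ (μ w) = w)
    {f : V → V} (hf : f ∈ matchingFun (G.comap ι)) : extendBy ι μ f ∈ matchingFun G := by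
  intro w
  by_cases hw : w ∈ Set.range ι
  · obtain ⟨v, rfl⟩ := hw
    simp only [extendBy_apply, (hf v).2, and_true]
    exact (hf v).1
  · obtain ⟨h1, h2, h3⟩ := hμ w hw
    rw [extendBy_of_notMem ι μ f hw, extendBy_of_notMem ι μ f h2]
    exact ⟨h1, h3⟩

/-- There are |W|² - |V|² ordered pairs meeting the complement of the range, so the dart bound
allows a quarter of that many new edges, the change in n²/4, plus one edge for each matching
differing there from a fixed extension. -/
theorem excess_comap_le {V W : Type*} [Finite V] [Finite W] {ι : V ↪ W} {G : SimpleGraph W}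
    {μ : W → W}
    (hμ : ∀ w, w ∉ Set.range ι → G.Adj w (μ w) ∧ μ w ∉ Set.range ι ∧ μ (μ w) = w)
    (hne : (matchingFun (G.comap ι)).Nonempty) :
    excess G + (matchingFun (G.comap ι)).ncard ≤
      excess (G.comap ι) + (matchingFun G).ncard := by
  classical
  have := Fintype.ofFinite W
  obtain ⟨f₀, hf₀⟩ := hne
  set S : Set W := (Set.range ι)ᶜ with hS
  have hmain := two_mul_card_darts_le (extendBy_mem hμ hf₀) (S := S) (by
    intro w hw
    rw [extendBy_of_notMem ι μ f₀ hw]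
    exact (hμ w hw).2.1)
  set N : Set (W → W) := {g ∈ matchingFun G | ∃ w ∈ S, g w ≠ extendBy ι μ f₀ w} with hN
  -- Extensions agree with `μ` off the range, so they are disjoint from the matchings in `N`.
  have hnew : (matchingFun (G.comap ι)).ncard + N.ncard ≤ (matchingFun G).ncard := by
    rw [← Set.ncard_image_of_injective (matchingFun (G.comap ι)) (extendBy_injective ι μ), ← Set.ncard_union_eq]
    · refine Set.ncard_le_ncard (Set.union_subset ?_ fun g hg => hg.1)
      rintro _ ⟨f, hf, rfl⟩
      exact extendBy_mem hμ hf
    · rw [Set.disjoint_left]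
      rintro _ ⟨f, hf, rfl⟩ ⟨-, w, hw, hne⟩
      exact hne (by rw [extendBy_of_notMem ι μ f hw, extendBy_of_notMem ι μ f₀ hw])
  have hpairs : {p : W × W | p.1 ∈ S ∨ p.2 ∈ S}.ncard + Nat.card V ^ 2 = Nat.card W ^ 2 := by
    have h1 : {p : W × W | p.1 ∈ S ∨ p.2 ∈ S}ᶜ = Set.range (Prod.map ι ι) := by
      rw [Set.range_prodMap]
      ext ⟨a, b⟩
      simp [hS]
    have h2 := Set.ncard_add_ncard_compl {p : W × W | p.1 ∈ S ∨ p.2 ∈ S}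
    rw [h1, ← Set.image_univ, Set.ncard_image_of_injective _ (ι.injective.prodMap ι.injective),
      Set.ncard_univ, Nat.card_prod, Nat.card_prod] at h2
    rw [sq, sq, h2]
  have hdarts : 2 * (G.comap ι).edgeSet.ncard +
      {p : W × W | G.Adj p.1 p.2 ∧ (p.1 ∈ S ∨ p.2 ∈ S)}.ncard = 2 * G.edgeSet.ncard := by
    rw [two_mul_ncard_edgeSet, two_mul_ncard_edgeSet,
      ← Set.ncard_image_of_injective _ (ι.injective.prodMap ι.injective), ← Set.ncard_union_eq]
    · congr 1
      ext ⟨a, b⟩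
      simp only [Set.mem_union, Set.mem_image, Set.mem_ofPred_eq, Prod.exists, Prod.map_apply,
        Prod.mk.injEq, SimpleGraph.comap_adj]
      constructor
      · rintro (⟨x, y, h, rfl, rfl⟩ | h)
        exacts [h, h.1]
      · intro h
        by_cases ha : a ∈ Set.range ι
        · by_cases hb : b ∈ Set.range ι
          · obtain ⟨x, rfl⟩ := ha
            obtain ⟨y, rfl⟩ := hb
            exact Or.inl ⟨x, y, h, rfl, rfl⟩
          · exact Or.inr ⟨h, Or.inr hb⟩
        · exact Or.inr ⟨h, Or.inl ha⟩
    · rw [Set.disjoint_left]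
      rintro _ ⟨⟨x, y⟩, -, rfl⟩ ⟨-, h | h⟩
      exacts [h ⟨x, rfl⟩, h ⟨y, rfl⟩]
  unfold excess
  have e1 : (2 : ℚ) * {p : W × W | G.Adj p.1 p.2 ∧ (p.1 ∈ S ∨ p.2 ∈ S)}.ncard ≤
      {p : W × W | p.1 ∈ S ∨ p.2 ∈ S}.ncard + 4 * N.ncard := by exact_mod_cast hmain
  have e2 : ((matchingFun (G.comap ι)).ncard : ℚ) + N.ncard ≤ (matchingFun G).ncard := by
    exact_mod_cast hnew
  have e3 : ({p : W × W | p.1 ∈ S ∨ p.2 ∈ S}.ncard : ℚ) + (Nat.card V : ℚ) ^ 2 =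
      (Nat.card W : ℚ) ^ 2 := by exact_mod_cast hpairs
  have e4 : 2 * ((G.comap ι).edgeSet.ncard : ℚ) +
      {p : W × W | G.Adj p.1 p.2 ∧ (p.1 ∈ S ∨ p.2 ∈ S)}.ncard = 2 * G.edgeSet.ncard := by
    exact_mod_cast hdarts
  linarith

/-- If `H` lies in the graph induced by `G` on a vertex set whose complement is perfectly matched
in `G`, then some member of `ℰ(H)` has excess at least `c(G) - (Φ(G) - Φ(H))`. -/
theorem exists_elementarySupergraph {V W : Type*} [Finite V] [Finite W] {ι : V ↪ W}
    {G : SimpleGraph W} {H : SimpleGraph V} (hH : IsOneExtendable H)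
    (hne : (matchingFun H).Nonempty) (hle : H ≤ G.comap ι) {μ : W → W}
    (hμ : ∀ w, w ∉ Set.range ι → G.Adj w (μ w) ∧ μ w ∉ Set.range ι ∧ μ (μ w) = w) :
    numPM H ≤ numPM G ∧
      ∃ G₀ ∈ elementarySupergraphs H, excess G + numPM H ≤ excess G₀ + numPM G := by
  obtain ⟨G₀, h1, h2, h3, h4⟩ := exists_between_matchingFun_eq hle
  have h5 := excess_comap_le hμ (hne.mono (matchingFun_mono hle))
  constructor
  · rw [numPM_eq, numPM_eq, ← Set.ncard_image_of_injective _ (extendBy_injective ι μ)]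
    refine Set.ncard_le_ncard ?_
    rintro _ ⟨f, hf, rfl⟩
    exact extendBy_mem hμ (matchingFun_mono hle hf)
  · refine ⟨G₀, ⟨isElementary_of_le hH hne h1, h1, by rw [numPM_eq, numPM_eq, h3]⟩, ?_⟩
    rw [numPM_eq, numPM_eq]
    have h6 : ((G.comap ι).edgeSet.ncard : ℚ) + (matchingFun H).ncard ≤
        G₀.edgeSet.ncard + (matchingFun (G.comap ι)).ncard := by exact_mod_cast h4
    unfold excess at h5 ⊢
    linarith

/-! ### Ears give matched extensions -/

/-- `H'` contains `H`, has finitely many further vertices, and these are perfectly matched to each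
other by edges of `H'`. -/
def IsMatchedExtension {U : Type*} (H H' : GraphIn U) : Prop :=
  H ≤ H' ∧ (H'.verts \ H.verts).Finite ∧ ∃ μ : U → U, ∀ w ∈ H'.verts \ H.verts,
    H'.Adj w (μ w) ∧ μ w ∉ H.verts ∧ μ (μ w) = w

theorem IsMatchedExtension.refl {U : Type*} (H : GraphIn U) : IsMatchedExtension H H :=
  ⟨le_rfl, by simp, id, by simp⟩

theorem IsMatchedExtension.trans {U : Type*} {H₁ H₂ H₃ : GraphIn U}
    (h : IsMatchedExtension H₁ H₂) (h' : IsMatchedExtension H₂ H₃) :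
    IsMatchedExtension H₁ H₃ := by
  classical
  obtain ⟨hle, hfin, μ, hμ⟩ := h
  obtain ⟨hle', hfin', μ', hμ'⟩ := h'
  refine ⟨hle.trans hle', (hfin.union hfin').subset ?_,
    fun w => if w ∈ H₂.verts then μ w else μ' w, ?_⟩
  · rintro w ⟨h3, h1⟩
    by_cases h2 : w ∈ H₂.verts
    exacts [Or.inl ⟨h2, h1⟩, Or.inr ⟨h3, h2⟩]
  · rintro w ⟨h3, h1⟩
    by_cases h2 : w ∈ H₂.verts
    · obtain ⟨ha, hb, hc⟩ := hμ w ⟨h2, h1⟩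
      simp only [h2, ha.snd_mem, if_true]
      exact ⟨hle'.2 ha, hb, hc⟩
    · obtain ⟨ha, hb, hc⟩ := hμ' w ⟨h3, h2⟩
      simp only [h2, hb, if_false]
      exact ⟨ha, fun hd => hb (hle.1 hd), hc⟩

theorem Ear.mem_internal_iff {U : Type*} {H : GraphIn U} (ε : Ear H) (w : U) :
    w ∈ ε.internal ↔ ∃ k, 0 < k ∧ k < ε.path.length ∧ ε.path.getVert k = w := by
  have h0 := ε.path.getVert_zero
  have hl := ε.path.getVert_length
  have hinj : ∀ i j, i ≤ ε.path.length → j ≤ ε.path.length →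
      ε.path.getVert i = ε.path.getVert j → i = j :=
    fun i j hi hj h => ε.isPath.getVert_injOn hi hj h
  constructor
  · rintro ⟨h, hx, hy⟩
    obtain ⟨k, rfl, hk⟩ := SimpleGraph.Walk.mem_support_iff_exists_getVert.1 h
    refine ⟨k, Nat.pos_of_ne_zero ?_, lt_of_le_of_ne hk ?_, rfl⟩
    · rintro rfl
      exact hx h0
    · intro hk'
      exact hy (by rw [hk', hl])
  · rintro ⟨k, hk, hk', rfl⟩
    refine ⟨ε.path.getVert_mem_support k, fun h => ?_, fun h => ?_⟩
    · have := hinj k 0 hk'.le (Nat.zero_le _) (h.trans h0.symm)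
      omega
    · have := hinj k ε.path.length hk'.le le_rfl (h.trans hl.symm)
      omega

theorem Ear.order_add_one {U : Type*} {H : GraphIn U} (ε : Ear H) :
    ε.order + 1 = ε.path.length := by
  have himg : ε.internal = ε.path.getVert '' (Finset.Ioo 0 ε.path.length : Set ℕ) := by
    ext w
    rw [ε.mem_internal_iff]
    simp [and_assoc]
  have hpos : 0 < ε.path.length := by
    rw [Nat.pos_iff_ne_zero]
    exact fun h => ε.ne (SimpleGraph.Walk.eq_of_length_eq_zero h)
  rw [Ear.order, himg, Set.InjOn.ncard_image, Set.ncard_coe_finset, Nat.card_Ioo]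
  · omega
  · refine ε.isPath.getVert_injOn.mono ?_
    intro k hk
    simp only [Finset.coe_Ioo, Set.mem_Ioo] at hk
    exact hk.2.le

theorem Ear.exists_matching_internal {U : Type*} {H : GraphIn U} (ε : Ear H) (h : Even ε.order) :
    ∃ μ : U → U, ∀ w ∈ ε.internal,
      ε.path.toSubgraph.Adj w (μ w) ∧ μ w ∈ ε.internal ∧ μ (μ w) = w := by
  classical
  have hlen := ε.order_add_one
  have hinj : ∀ i j, i ≤ ε.path.length → j ≤ ε.path.length →
      ε.path.getVert i = ε.path.getVert j → i = j :=
    fun i j hi hj h => ε.isPath.getVert_injOn hi hj h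
  -- The path has odd length, so its internal positions 1, ..., length - 1 pair off as (1,2), (3,4),
  -- ...
  have key : ∀ w : U, ∃ u : U, ∀ k, 0 < k → k < ε.path.length → ε.path.getVert k = w →
      u = ε.path.getVert (if Even k then k - 1 else k + 1) := by
    intro w
    by_cases hw : w ∈ ε.internal
    · obtain ⟨k, hk, hk', rfl⟩ := (ε.mem_internal_iff w).1 hw
      refine ⟨ε.path.getVert (if Even k then k - 1 else k + 1), fun j _ hj' hjk => ?_⟩
      rw [hinj j k hj'.le hk'.le hjk]
    · exact ⟨w, fun k hk hk' h => absurd ((ε.mem_internal_iff w).2 ⟨k, hk, hk', h⟩) hw⟩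
  choose μ hμ using key
  refine ⟨μ, fun w hw => ?_⟩
  obtain ⟨k, hk, hk', rfl⟩ := (ε.mem_internal_iff w).1 hw
  rw [hμ _ k hk hk' rfl]
  by_cases hev : Even k
  · have hodd : ¬ Even (k - 1) := by grind
    have h1 : 0 < k - 1 := by grind
    have h2 : k - 1 + 1 = k := by omega
    rw [if_pos hev]
    refine ⟨?_, (ε.mem_internal_iff _).2 ⟨k - 1, h1, by omega, rfl⟩, ?_⟩
    · have := ε.path.toSubgraph_adj_getVert (i := k - 1) (by omega)
      rw [h2] at this
      exact this.symm
    · rw [hμ _ (k - 1) h1 (by omega) rfl, if_neg hodd, h2]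
  · have hev' : Even (k + 1) := by grind
    have h1 : k + 1 < ε.path.length := by grind
    rw [if_neg hev]
    refine ⟨ε.path.toSubgraph_adj_getVert hk',
      (ε.mem_internal_iff _).2 ⟨k + 1, by omega, h1, rfl⟩, ?_⟩
    rw [hμ _ (k + 1) (by omega) h1 rfl, if_pos hev', Nat.add_sub_cancel]

theorem IsEarAugmentation.isMatchedExtension {U : Type*} {H H' : GraphIn U}
    (h : IsEarAugmentation H H') : IsMatchedExtension H H' := by
  classical
  obtain ⟨m, ε, heven, hdisj, rfl⟩ := h
  choose μ hμ using fun i => (ε i).exists_matching_internal (heven i)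
  have hnew : ∀ i, ∀ w ∈ (ε i).internal, w ∉ H.verts := fun i w hw =>
    (ε i).internal_new w hw.1 hw.2.1 hw.2.2
  have hmem : ∀ w, w ∈ (H ⊔ ⨆ i, (ε i).path.toSubgraph).verts \ H.verts →
      ∃ i, w ∈ (ε i).internal := by
    rintro w ⟨h1, h2⟩
    rw [SimpleGraph.Subgraph.verts_sup, SimpleGraph.Subgraph.verts_iSup] at h1
    obtain h1 | h1 := h1
    · exact absurd h1 h2
    · obtain ⟨i, hi⟩ := Set.mem_iUnion.1 h1
      refine ⟨i, (SimpleGraph.Walk.mem_verts_toSubgraph _).1 hi, ?_, ?_⟩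
      · rintro rfl
        exact h2 (ε i).x_mem
      · rintro rfl
        exact h2 (ε i).y_mem
  have huniq : ∀ i j w, w ∈ (ε i).internal → w ∈ (ε j).internal → i = j := by
    intro i j w hi hj
    by_contra hij
    exact Set.disjoint_left.1 (hdisj i j hij).1 hi hj
  have hle : ∀ i, (ε i).path.toSubgraph ≤ H ⊔ ⨆ i, (ε i).path.toSubgraph := fun i =>
    (le_iSup (fun i => (ε i).path.toSubgraph) i).trans le_sup_right
  refine ⟨le_sup_left, (Set.finite_iUnion fun i => ?_).subset
    (fun w hw => Set.mem_iUnion.2 (hmem w hw)),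
    fun w => if hw : ∃ i, w ∈ (ε i).internal then μ hw.choose w else w, ?_⟩
  · exact ((ε i).path.support.finite_toSet).subset fun w hw => hw.1
  · have hval : ∀ i, ∀ w ∈ (ε i).internal,
        (if hw : ∃ i, w ∈ (ε i).internal then μ hw.choose w else w) = μ i w := by
      intro i w hi
      have hw : ∃ i, w ∈ (ε i).internal := ⟨i, hi⟩
      rw [dif_pos hw, huniq _ i w hw.choose_spec hi]
    intro w hw
    obtain ⟨i, hi⟩ := hmem w hw
    obtain ⟨h1, h2, h3⟩ := hμ i w hi
    simp only [hval i w hi, hval i _ h2]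
    exact ⟨(hle i).2 h1, hnew i _ h2, h3⟩

theorem IsReachable.isMatchedExtension {U : Type*} {H H' : GraphIn U} (h : IsReachable H H') :
    IsMatchedExtension H H' := by
  obtain ⟨k, F, ⟨-, hF⟩, rfl, rfl⟩ := h
  have : ∀ i, IsMatchedExtension (F 0) (F i) := by
    intro i
    induction i using Fin.induction with
    | zero => exact IsMatchedExtension.refl _
    | succ i ih => exact ih.trans (hF i).isMatchedExtension
  exact this _

end PMExcess

/-! ### The pruning bound -/

theorem mainTheorem11 {U : Type*} (p c : ℕ) (hp : 1 ≤ p) (hc : 1 ≤ c)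
    (H : PMExcess.GraphIn U) (hfin : H.verts.Finite)
    (hH : PMExcess.IsOneExtendable H.coe)
    (q : ℕ) (hq : PMExcess.numPM H.coe = q)
    (c' : ℚ)
    (hc' : IsGreatest (PMExcess.excess '' PMExcess.elementarySupergraphs H.coe) c')
    (hprune : c' + 2 * ((p : ℚ) - (q : ℚ)) < (c : ℚ)) :
    ¬ ∃ H' : PMExcess.GraphIn U,
        PMExcess.IsOneExtendable H'.coe ∧
        PMExcess.IsReachable H H' ∧
        PMExcess.numPM H'.coe = p ∧
        ∃ G' ∈ PMExcess.elementarySupergraphs H'.coe, (c : ℚ) ≤ PMExcess.excess G' := by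
  rintro ⟨H', -, hreach, hp', G', ⟨-, hle', hnum⟩, hexc⟩
  obtain ⟨hle, hfin', μ, hμ⟩ := hreach.isMatchedExtension
  have hV : Finite H.verts := hfin
  have hW : Finite H'.verts := ((hfin'.union hfin).subset fun w hw => by
    by_cases h : w ∈ H.verts
    exacts [Or.inr h, Or.inl ⟨hw, h⟩] : H'.verts.Finite)
  -- A single vertex is 1-extendable without a perfect matching; the member of ℰ(H) attaining `c'`
  -- excludes this case.
  have hne : (PMExcess.matchingFun H.coe).Nonempty := by
    obtain ⟨⟨G₀, ⟨⟨hM, -⟩, -, hG₀⟩, -⟩, -⟩ := hc'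
    have h := PMExcess.exists_isPerfectMatching_iff.1 hM
    rw [← Set.ncard_pos, ← PMExcess.numPM_eq] at h ⊢
    omega
  have hrange : ∀ w : H'.verts, w ∉ Set.range (Set.embeddingOfSubset _ _ hle.1) ↔
      w.1 ∉ H.verts := by
    intro w
    rw [not_iff_not]
    constructor
    · rintro ⟨v, rfl⟩
      exact v.2
    · exact fun h => ⟨⟨w.1, h⟩, rfl⟩
  have hmem : ∀ w : H'.verts, w.1 ∉ H.verts → μ w ∈ H'.verts := fun w hw =>
    (hμ w ⟨w.2, hw⟩).1.snd_mem
  classical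
  obtain ⟨hpq, G₀, hG₀, hG₀'⟩ := PMExcess.exists_elementarySupergraph (G := G')
    (ι := Set.embeddingOfSubset _ _ hle.1) hH hne
    (fun a b hab => hle' (hle.2 hab))
    (μ := fun w => if hw : w.1 ∉ H.verts then ⟨μ w, hmem w hw⟩ else w) (by
      intro w hw
      rw [hrange] at hw
      obtain ⟨h1, h2, h3⟩ := hμ w ⟨w.2, hw⟩
      simp only [hrange, hw, h2, h3, not_false_eq_true, dite_true, and_true]
      exact hle' h1)
  have hmax := hc'.2 ⟨G₀, hG₀, rfl⟩
  rw [hnum, hp', hq] at hpq hG₀'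
  have : (q : ℚ) ≤ p := by exact_mod_cast hpq
  linarith
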